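/- Let $G=(V,E)$ be a finite connected simple graph of order $n=|V|$ and let $k\ge 1$. In the game of $k$ cops against the unknown gambler on $G$, the gambler fixes a probability distribution $p$ on $V$, and the cops choose their initial positions at vertices of $G$ (several cops may share a vertex). In each round $r=1,2,\dots$, simultaneously, every cop stays where it is or moves to a neighbouring vertex, and the gambler occupies a vertex drawn from $p$, independently of everything else. The gambler is captured in the first round after whose moves some cop occupies the same vertex as the gambler, and the capture time is the number of that round ($\infty$ if there is none). The game is played in darkness and the cops do not know $p$, so a (randomized) strategy $\sigma$ of the $k$ cops is a probability distribution on the sequences of joint positions of the team (initial placement and moves) that does not depend on $p$ or on the gambler's moves. Let $T$ denote the capture time and define $$\operatorname{ect}_{u,k}(G)=\inf_{\sigma}\,\sup_{p}\ \mathbb{E}_{\sigma,p}[T],\qquad \operatorname{th}_u(G)=\min_{k\ge 1}\bigl(k+\operatorname{ect}_{u,k}(G)\bigr).$$ Theorem. There is an integer $N$ such that for every $n\ge N$ and every connected graph $G$ of order $n$, $$\operatorname{th}_u(G)<3.7131\,\sqrt{n}.$$ -/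

import Mathlib

open scoped ENNReal
open MeasureTheory

namespace CopGambler

variable {V : Type*}

/-- A play of `k` cops on `G`: `w r i` is the position of cop `i` after round `r`, and `w 0` is the
freely chosen initial placement. In each round every cop stays put or moves to an adjacent vertex;
several cops may share a vertex. -/
def IsCopPlay (G : SimpleGraph V) {k : ℕ} (w : ℕ → Fin k → V) : Prop :=
  ∀ r i, w (r + 1) i = w r i ∨ G.Adj (w r i) (w (r + 1) i)

/-- The number of rounds until capture (`⊤` if there is none). In round `r + 1` the cops move to
`w (r + 1)` while the gambler simultaneously occupies `g r`; the gambler is captured in that round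
if some cop is at the same vertex. -/
noncomputable def captureTime {k : ℕ} (w : ℕ → Fin k → V) (g : ℕ → V) : ℕ∞ :=
  ⨅ (r : ℕ) (_ : ∃ i, w (r + 1) i = g r), ((r + 1 : ℕ) : ℕ∞)

/-- The law of the gambler's trajectory: independent draws from `p`, one for each round. -/
noncomputable def gamblerLaw [MeasurableSpace V] (p : PMF V) : Measure (ℕ → V) :=
  Measure.infinitePi (fun _ : ℕ => p.toMeasure)

/-- The randomized strategies of `k` cops. The game is played in darkness, so the cops get no
information during the game, and such a strategy is a probability distribution on plays of the
whole team, independent of the gambler's distribution and of the gambler's moves. -/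
def copStrategies [MeasurableSpace V] (G : SimpleGraph V) (k : ℕ) :
    Set (ProbabilityMeasure (ℕ → Fin k → V)) :=
  {σ | ∀ᵐ w ∂(σ : Measure (ℕ → Fin k → V)), IsCopPlay G w}

/-- The expected capture time of a gambler with distribution `p` against the strategy `σ`, the
randomness of the two sides being independent. -/
noncomputable def expectedCaptureTime [MeasurableSpace V] {k : ℕ}
    (σ : ProbabilityMeasure (ℕ → Fin k → V)) (p : PMF V) : ℝ≥0∞ :=
  ∫⁻ x, (captureTime x.1 x.2 : ℝ≥0∞) ∂((σ : Measure (ℕ → Fin k → V)).prod (gamblerLaw p))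

/-- The expected capture time of the unknown gambler against `k` cops under optimal play: the cops
commit to a randomized strategy without knowing the gambler's distribution, which is then the
worst possible. -/
noncomputable def ectUnknown (G : SimpleGraph V) (k : ℕ) : ℝ≥0∞ :=
  letI : MeasurableSpace V := ⊤
  ⨅ σ ∈ copStrategies G k, ⨆ p : PMF V, expectedCaptureTime σ p

/-- The unknown-gambler throttling number: the minimum over all positive numbers `k` of cops of
`k` plus the expected capture time of the unknown gambler. -/
noncomputable def throttlingUnknown (G : SimpleGraph V) : ℝ≥0∞ :=
  ⨅ (k : ℕ) (_ : 1 ≤ k), ((k : ℝ≥0∞) + ectUnknown G k)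

end CopGambler

/-!
A deterministic strategy suffices. Adding the vertices one at a time, each along an edge to a vertex
already visited, produces a closed walk of length `2 (n - 1)` through all `n` vertices of a
connected graph (`exists_closed_walk_mem_support`). Place `k` cops on it at distance
`L = ⌈2n / k⌉` from each other and let all of them run along it forever in the same direction. In
every block of `L` consecutive rounds the team then visits every vertex (`exists_sweeping_play`).

If `q s` denotes the probability that the gambler sits on a cop in round `s`, then the `q s` of a
block sum to at least `1`, so the gambler survives the block with probability at most
`∏ (1 - q s) ≤ exp (-∑ q s) ≤ exp (-1)` (`prod_measure_compl_le`). As the draws are independent, the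
expected number of rounds is at most `L ∑ exp (-b) = L / (1 - exp (-1))`
(`lintegral_captureTime_le`), whatever the distribution `p` is. Since `2 / (1 - exp (-1)) < 3.164`,
choosing `k` close to `1.78 √n` gives a total of about `2 √(3.164 n) < 3.56 √n`, up to a bounded
rounding error.
-/

namespace CopGambler

/-! ### Closed walks through all vertices -/

theorem exists_closed_walk_card_support {V : Type*} [Fintype V] [DecidableEq V] {G : SimpleGraph V}
    (hG : G.Connected) (m : ℕ) (hm : m + 1 ≤ Fintype.card V) :
    ∃ (v : V) (c : G.Walk v v), c.length = 2 * m ∧ m + 1 ≤ c.support.toFinset.card := by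
  induction m with
  | zero =>
    obtain ⟨v⟩ := hG.nonempty
    exact ⟨v, .nil, by simp⟩
  | succ m ih =>
    obtain ⟨v, c, hlen, hcard⟩ := ih (by omega)
    by_cases hall : ∀ u, u ∈ c.support
    · -- All vertices are visited already: a detour to an arbitrary neighbour pads the length.
      have : Nontrivial V := Fintype.one_lt_card_iff_nontrivial.mp (by omega)
      obtain ⟨u, hu⟩ := hG.preconnected.exists_adj_of_nontrivial v
      refine ⟨v, .cons hu (.cons hu.symm c), by simp [hlen]; ring, ?_⟩
      have : (SimpleGraph.Walk.cons hu (.cons hu.symm c)).support.toFinset = Finset.univ := by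
        ext x
        simp [hall x]
      rw [this, Finset.card_univ]
      exact hm
    · push Not at hall
      obtain ⟨u, hu⟩ := hall
      obtain ⟨p⟩ := hG.preconnected v u
      obtain ⟨d, -, hd₁, hd₂⟩ :=
        p.exists_boundary_dart {x | x ∈ c.support} c.start_mem_support hu
      simp only [Set.mem_ofPred_eq] at hd₁ hd₂
      refine ⟨d.snd, .cons d.adj.symm ((c.rotate d.fst hd₁).concat d.adj),
        by simp [hlen]; ring, ?_⟩
      have hsub : insert d.snd c.support.toFinset ⊆
          (SimpleGraph.Walk.cons d.adj.symm
            ((c.rotate d.fst hd₁).concat d.adj)).support.toFinset := by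
        intro x hx
        simp only [Finset.mem_insert, List.mem_toFinset] at hx
        rcases hx with rfl | hx
        · simp
        · simp [SimpleGraph.Walk.support_concat, hx]
      have := Finset.card_le_card hsub
      rw [Finset.card_insert_of_notMem (by simpa using hd₂)] at this
      omega

theorem exists_closed_walk_mem_support {V : Type*} [Fintype V] {G : SimpleGraph V}
    (hG : G.Connected) :
    ∃ (v : V) (c : G.Walk v v), c.length = 2 * (Fintype.card V - 1) ∧ ∀ u, u ∈ c.support := by
  classical
  have := hG.nonempty
  have hpos : 0 < Fintype.card V := Fintype.card_pos
  obtain ⟨v, c, hlen, hcard⟩ :=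
    exists_closed_walk_card_support hG (Fintype.card V - 1) (by omega)
  refine ⟨v, c, hlen, fun u => ?_⟩
  have huniv : c.support.toFinset = Finset.univ := by
    rw [← Finset.card_eq_iff_eq_univ]
    exact le_antisymm (Finset.card_le_univ _) (by omega)
  rw [← List.mem_toFinset, huniv]
  exact Finset.mem_univ u

/-! ### The sweeping strategy -/

/-- Cops spaced `L` apart on a closed walk of length at most `k * L` through all vertices, all
running around it: each block of `L` consecutive rounds covers the whole graph. -/
theorem exists_sweeping_play {V : Type*} [Fintype V] {G : SimpleGraph V} (hG : G.Connected)
    (hV : 2 ≤ Fintype.card V) {k L : ℕ} (hkL : 2 * Fintype.card V ≤ k * L) :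
    ∃ w : ℕ → Fin k → V, IsCopPlay G w ∧
      ∀ b v, ∃ s < L, ∃ i, w (b * L + s + 1) i = v := by
  obtain ⟨v₀, c, hlen, hc⟩ := exists_closed_walk_mem_support hG
  have hM : 0 < c.length := by omega
  have hLpos : 0 < L := Nat.pos_of_ne_zero (by rintro rfl; omega)
  refine ⟨fun r i => c.getVert ((i * L + r) % c.length), fun r i => Or.inr ?_, fun b v => ?_⟩
  · change G.Adj (c.getVert ((i * L + r) % c.length)) (c.getVert ((i * L + (r + 1)) % c.length))
    have hlt := Nat.mod_lt (i * L + r) hM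
    have hadj := c.adj_getVert_succ hlt
    rcases Nat.lt_or_ge ((i * L + r) % c.length + 1) c.length with h | h
    · have : (i * L + (r + 1)) % c.length = (i * L + r) % c.length + 1 := by
        rw [← add_assoc, Nat.add_mod, Nat.mod_eq_of_lt (a := 1) (by omega), Nat.mod_eq_of_lt h]
      rwa [this]
    · have h' : (i * L + r) % c.length + 1 = c.length := by omega
      have : (i * L + (r + 1)) % c.length = 0 := by
        rw [← add_assoc, ← Nat.mod_add_mod, h', Nat.mod_self]
      rw [this, c.getVert_zero]
      rwa [h', c.getVert_length] at hadj
  · obtain ⟨j, hj, hjle⟩ := SimpleGraph.Walk.mem_support_iff_exists_getVert.mp (hc v)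
    -- The offset `t` is the number of steps from position `b * L + 1` of the walk to position `j`.
    obtain ⟨t, ht, htj⟩ : ∃ t < c.length, (b * L + 1 + t) % c.length = j % c.length := by
      refine ⟨(j + (c.length - (b * L + 1) % c.length)) % c.length, Nat.mod_lt _ hM, ?_⟩
      have hlt := Nat.mod_lt (b * L + 1) hM
      have hdiv := Nat.div_add_mod (b * L + 1) c.length
      have : b * L + 1 + (j + (c.length - (b * L + 1) % c.length)) =
          j + c.length * ((b * L + 1) / c.length + 1) := by
        rw [mul_add_one]
        omega
      rw [Nat.add_mod_mod, this, Nat.add_mul_mod_self_left]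
    have htk : t / L < k := by
      rw [Nat.div_lt_iff_lt_mul hLpos]
      omega
    refine ⟨t % L, Nat.mod_lt _ hLpos, ⟨t / L, htk⟩, ?_⟩
    have hidx : t / L * L + (b * L + t % L + 1) = b * L + 1 + t := by
      have := Nat.div_add_mod' t L
      omega
    simp only [hidx, htj]
    rcases hjle.lt_or_eq with h | h
    · rw [Nat.mod_eq_of_lt h, hj]
    · rw [h, Nat.mod_self, c.getVert_zero, ← hj, h, c.getVert_length]

/-! ### The expected capture time -/

theorem prod_measure_compl_le {α ι : Type*} [MeasurableSpace α] (μ : Measure α)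
    [IsProbabilityMeasure μ] (s : Finset ι) (S : ι → Set α) (hS : ∀ i ∈ s, MeasurableSet (S i))
    (hcover : ∀ x, ∃ i ∈ s, x ∈ S i) :
    ∏ i ∈ s, μ (S i)ᶜ ≤ ENNReal.ofReal (Real.exp (-1)) := by
  have hsum : 1 ≤ ∑ i ∈ s, μ.real (S i) := by
    have huniv : ⋃ i ∈ s, S i = Set.univ := by
      ext x
      simpa using hcover x
    have := measureReal_biUnion_finset_le (μ := μ) s S
    rwa [huniv, probReal_univ] at this
  calc ∏ i ∈ s, μ (S i)ᶜ ≤ ∏ i ∈ s, ENNReal.ofReal (Real.exp (-μ.real (S i))) := by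
        refine Finset.prod_le_prod' fun i hi => ?_
        rw [← ofReal_measureReal, probReal_compl_eq_one_sub (hS i hi)]
        exact ENNReal.ofReal_le_ofReal (Real.one_sub_le_exp_neg _)
    _ = ENNReal.ofReal (Real.exp (-∑ i ∈ s, μ.real (S i))) := by
        rw [← ENNReal.ofReal_prod_of_nonneg fun i _ => (Real.exp_pos _).le, ← Real.exp_sum,
          Finset.sum_neg_distrib]
    _ ≤ ENNReal.ofReal (Real.exp (-1)) := by gcongr

/-- The gambler trajectories that avoid the cops in the first `r` rounds. -/
def survivalSet {V : Type*} {k : ℕ} (w : ℕ → Fin k → V) (r : ℕ) : Set (ℕ → V) :=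
  Set.pi (Finset.range r) fun s => (Set.range (w (s + 1)))ᶜ

/-- The capture time exceeds `r` exactly on `survivalSet w r`, and a number in `ℕ∞` is the number
of `r : ℕ` below it. -/
theorem captureTime_le_tsum {V : Type*} {k : ℕ} (w : ℕ → Fin k → V) (g : ℕ → V) :
    (captureTime w g : ℝ≥0∞) ≤ ∑' r, (survivalSet w r).indicator 1 g := by
  classical
  by_cases h : ∃ r, ∃ i, w (r + 1) i = g r
  · have hle : captureTime w g ≤ ((Nat.find h + 1 : ℕ) : ℕ∞) :=
      iInf₂_le (Nat.find h) (Nat.find_spec h)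
    calc (captureTime w g : ℝ≥0∞) ≤ (((Nat.find h + 1 : ℕ) : ℕ∞) : ℝ≥0∞) := by exact_mod_cast hle
      _ = ∑ r ∈ Finset.range (Nat.find h + 1), 1 := by simp
      _ = ∑ r ∈ Finset.range (Nat.find h + 1), (survivalSet w r).indicator 1 g := by
        refine Finset.sum_congr rfl fun r hr => ?_
        rw [Set.indicator_of_mem, Pi.one_apply]
        intro s hs
        simp only [Finset.coe_range, Set.mem_Iio, Finset.mem_range] at hs hr
        exact Nat.find_min h (by omega)
      _ ≤ _ := ENNReal.sum_le_tsum _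
  · have hmem (r : ℕ) : g ∈ survivalSet w r := fun s _ hs => h ⟨s, hs⟩
    simp [hmem]

theorem gamblerLaw_survivalSet {V : Type*} [MeasurableSpace V] [DiscreteMeasurableSpace V] {k : ℕ}
    (w : ℕ → Fin k → V) (p : PMF V) (r : ℕ) :
    gamblerLaw p (survivalSet w r) =
      ∏ s ∈ Finset.range r, p.toMeasure (Set.range (w (s + 1)))ᶜ :=
  Measure.infinitePi_pi _ fun _ _ => .of_discrete

/-- If each block of `L` rounds covers all vertices, the gambler survives `b` blocks with
probability at most `exp (-1) ^ b`; summing over all rounds bounds the expected capture time. -/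
theorem lintegral_captureTime_le {V : Type*} [MeasurableSpace V] [DiscreteMeasurableSpace V]
    {k L : ℕ} (hL : 0 < L) (w : ℕ → Fin k → V)
    (hw : ∀ b v, ∃ s < L, ∃ i, w (b * L + s + 1) i = v) (p : PMF V) :
    ∫⁻ g, (captureTime w g : ℝ≥0∞) ∂gamblerLaw p ≤
      L * (1 - ENNReal.ofReal (Real.exp (-1)))⁻¹ := by
  have hblock (b : ℕ) :
      gamblerLaw p (survivalSet w (b * L)) ≤ ENNReal.ofReal (Real.exp (-1)) ^ b := by
    induction b with
    | zero => simp [gamblerLaw_survivalSet]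
    | succ b ih =>
      rw [gamblerLaw_survivalSet, add_one_mul, Finset.prod_range_add, ← gamblerLaw_survivalSet,
        pow_succ]
      refine mul_le_mul' ih (prod_measure_compl_le _ _ (fun s => Set.range (w (b * L + s + 1)))
        (fun _ _ => .of_discrete) fun v => ?_)
      obtain ⟨s, hs, hv⟩ := hw b v
      exact ⟨s, Finset.mem_range.mpr hs, hv⟩
  have : NeZero L := ⟨hL.ne'⟩
  calc ∫⁻ g, (captureTime w g : ℝ≥0∞) ∂gamblerLaw p
      ≤ ∫⁻ g, ∑' r, (survivalSet w r).indicator 1 g ∂gamblerLaw p :=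
        lintegral_mono fun g => captureTime_le_tsum w g
    _ = ∑' r, gamblerLaw p (survivalSet w r) := by
        have hmeas (r : ℕ) : MeasurableSet (survivalSet w r) :=
          .pi (Finset.countable_toSet _) fun _ _ => .of_discrete
        rw [lintegral_tsum fun r => (measurable_one.indicator (hmeas r)).aemeasurable]
        simp_rw [lintegral_indicator_one (hmeas _)]
    _ = ∑' (b : ℕ) (s : Fin L), gamblerLaw p (survivalSet w (b * L + s)) := by
        rw [← (Nat.divModEquiv L).symm.tsum_eq, ENNReal.tsum_prod']
        simp [Nat.divModEquiv, mul_comm]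
    _ ≤ ∑' (b : ℕ) (_ : Fin L), ENNReal.ofReal (Real.exp (-1)) ^ b := by
        refine ENNReal.tsum_le_tsum fun b => ENNReal.tsum_le_tsum fun s => ?_
        refine (measure_mono ?_).trans (hblock b)
        exact Set.pi_mono' (fun _ _ => subset_rfl) (by
          simp only [Finset.coe_range]
          exact Set.Iio_subset_Iio (by omega))
    _ = L * (1 - ENNReal.ofReal (Real.exp (-1)))⁻¹ := by
        simp [ENNReal.tsum_mul_left, ENNReal.tsum_geometric]

theorem ectUnknown_le {V : Type*} [Fintype V] {G : SimpleGraph V} (hG : G.Connected)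
    (hV : 2 ≤ Fintype.card V) {k L : ℕ} (hkL : 2 * Fintype.card V ≤ k * L) :
    ectUnknown G k ≤ L * (1 - ENNReal.ofReal (Real.exp (-1)))⁻¹ := by
  let _ : MeasurableSpace V := ⊤
  obtain ⟨w, hplay, hw⟩ := exists_sweeping_play hG hV hkL
  have hL : 0 < L := Nat.pos_of_ne_zero (by rintro rfl; omega)
  let σ : ProbabilityMeasure (ℕ → Fin k → V) := ⟨Measure.dirac w, inferInstance⟩
  have hσ : σ ∈ copStrategies G k := by
    change ∀ᵐ w' ∂(Measure.dirac w), IsCopPlay G w'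
    rw [ae_dirac_eq]
    exact hplay
  refine (iInf₂_le σ hσ).trans (iSup_le fun p => ?_)
  calc expectedCaptureTime σ p
      ≤ ∫⁻ w', ∫⁻ g, (captureTime w' g : ℝ≥0∞) ∂gamblerLaw p ∂(Measure.dirac w) :=
        lintegral_prod_le _
    _ = ∫⁻ g, (captureTime w g : ℝ≥0∞) ∂gamblerLaw p := lintegral_dirac _ _
    _ ≤ _ := lintegral_captureTime_le hL w hw p

/-! ### Choosing the number of cops -/

theorem inv_one_sub_ofReal_exp_neg_one_le :
    (1 - ENNReal.ofReal (Real.exp (-1)))⁻¹ ≤ ENNReal.ofReal 1.583 := by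
  have hexp : Real.exp (-1) < 0.368 := by
    rw [Real.exp_neg]
    have := Real.exp_one_gt_d9
    rw [inv_lt_comm₀ (Real.exp_pos 1) (by norm_num)]
    norm_num
    linarith
  rw [← ENNReal.ofReal_one, ← ENNReal.ofReal_sub _ (Real.exp_pos _).le,
    ← ENNReal.ofReal_inv_of_pos (by linarith)]
  refine ENNReal.ofReal_le_ofReal (inv_le_of_inv_le₀ (by norm_num) ?_)
  norm_num
  linarith

end CopGambler

open CopGambler in
theorem theorem3p5 :
    ∃ N : ℕ, ∀ n : ℕ, N ≤ n → ∀ (V : Type*) [Fintype V] (G : SimpleGraph V),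
      Fintype.card V = n → G.Connected →
        CopGambler.throttlingUnknown G < ENNReal.ofReal (3.7131 * Real.sqrt (n : ℝ)) := by
  refine ⟨400, fun n hn V _ G hcard hG => ?_⟩
  have hn' : (400 : ℝ) ≤ n := by exact_mod_cast hn
  have hsq : √(n : ℝ) * √n = n := Real.mul_self_sqrt (by positivity)
  have hx : 20 ≤ √(n : ℝ) := Real.le_sqrt_of_sq_le (by linarith)
  set x := √(n : ℝ)
  -- The real optimum is `√(2n / (1 - exp (-1)))`, about `1.78 √n`.
  set k := ⌈1.78 * x⌉₊
  set L := ⌈x / 0.89⌉₊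
  have hk₁ : 1.78 * x ≤ k := Nat.le_ceil _
  have hk₂ : k < 1.78 * x + 1 := Nat.ceil_lt_add_one (by positivity)
  have hL₁ : x / 0.89 ≤ L := Nat.le_ceil _
  have hL₂ : L < x / 0.89 + 1 := Nat.ceil_lt_add_one (by positivity)
  have hkL : 2 * n ≤ k * L := by
    have h := mul_le_mul hk₁ hL₁ (by positivity) (by positivity)
    have h' : 1.78 * x * (x / 0.89) = 2 * n := by rw [← hsq]; ring
    rw [h'] at h
    exact_mod_cast h
  have hk : 1 ≤ k := by
    have : (0 : ℝ) < k := by linarith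
    exact_mod_cast this
  calc throttlingUnknown G ≤ k + ectUnknown G k := iInf₂_le k hk
    _ ≤ k + L * ENNReal.ofReal 1.583 := by
        gcongr
        refine (ectUnknown_le (L := L) hG (by omega) (hcard.symm ▸ hkL)).trans ?_
        gcongr
        exact inv_one_sub_ofReal_exp_neg_one_le
    _ = ENNReal.ofReal (k + L * 1.583) := by
        rw [ENNReal.ofReal_add (by positivity) (by positivity),
          ENNReal.ofReal_mul (by positivity), ENNReal.ofReal_natCast, ENNReal.ofReal_natCast]
    _ < ENNReal.ofReal (3.7131 * x) := by
        rw [ENNReal.ofReal_lt_ofReal_iff (by positivity)]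
        norm_num at hL₂ hk₂ ⊢
        linarith
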